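/- An occurrence of the pattern $1\text{-}2\text{-}3$ in a permutation $\pi=\pi_1\pi_2\cdots\pi_n$ of $\{1,\dots,n\}$ is a triple of positions $i<j<k$ with $\pi_i<\pi_j<\pi_k$; an occurrence of the pattern $1\text{-}23$ is such a triple with $k=j+1$. For $n\ge 0$ let $b_n$ be the number of permutations of length $n$ with exactly one occurrence of $1\text{-}23$ and exactly one occurrence of $1\text{-}2\text{-}3$. Let $C(x)=\sum_{n\ge 0}\frac{1}{n+1}\binom{2n}{n}x^n$ be the Catalan generating function. Then, as formal power series, $$\sum_{n\ge 0} b_n x^n = x^3\,C(x)^5 = \sum_{n\ge 3}\frac{5}{n+2}\binom{2n-2}{n+1}x^n ,$$ that is, the generating function of $(b_n)$ is $x^3C(x)^5$, and $b_n=\frac{5}{n+2}\binom{2n-2}{n+1}$ for all $n\ge 3$ (while $b_0=b_1=b_2=0$). -/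

import Mathlib

/-- The occurrences of the pattern 1-2-3 in the permutation `π 0, π 1, …, π (n - 1)`: triples of
positions `i < j < k`, none of them required to be adjacent, with `π i < π j < π k`. -/
def occ_1_2_3 {n : ℕ} (π : Equiv.Perm (Fin n)) : Finset (Fin n × Fin n × Fin n) :=
  Finset.univ.filter fun t =>
    t.1 < t.2.1 ∧ t.2.1 < t.2.2 ∧ π t.1 < π t.2.1 ∧ π t.2.1 < π t.2.2

/-- The occurrences of the pattern 1-23: triples of positions `i < j < k` with
`π i < π j < π k` in which the last two positions are adjacent, `k = j + 1`. -/
def occ_1_23 {n : ℕ} (π : Equiv.Perm (Fin n)) : Finset (Fin n × Fin n × Fin n) :=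
  Finset.univ.filter fun t =>
    t.1 < t.2.1 ∧ (t.2.2 : ℕ) = (t.2.1 : ℕ) + 1 ∧ π t.1 < π t.2.1 ∧ π t.2.1 < π t.2.2

/-- The number of permutations of length `n` with exactly one occurrence of 1-23
and exactly one occurrence of 1-2-3. -/
def numSingle (n : ℕ) : ℕ :=
  (Finset.univ.filter fun π : Equiv.Perm (Fin n) =>
    (occ_1_23 π).card = 1 ∧ (occ_1_2_3 π).card = 1).card

/-- The Catalan generating function `C(x) = ∑ C_n x ^ n`, as a formal power series over `ℚ`. -/
noncomputable def catalanGF : PowerSeries ℚ :=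
  PowerSeries.map (Nat.castRingHom ℚ) PowerSeries.catalanSeries

theorem coeff_catalanGF (n : ℕ) :
    PowerSeries.coeff n catalanGF = 1 / ((n : ℚ) + 1) * ((2 * n).choose n : ℚ) := by
  have h : (((n + 1) * catalan n : ℕ) : ℚ) = ((2 * n).choose n : ℚ) := by
    rw [succ_mul_catalan_eq_centralBinom, Nat.centralBinom]
  have h0 : (n : ℚ) + 1 ≠ 0 := by positivity
  simp only [catalanGF, PowerSeries.coeff_map, PowerSeries.catalanSeries_coeff, ← h]
  push_cast
  field_simp

/-!
A permutation counted by `numSingle` has a single occurrence `(i, j, k)` of 1-2-3, and `k = j + 1`.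
Write `a < b < c` for its entries. An entry before `b` other than `a` exceeds `b`, and an entry
after `b` other than `c` is less than `b`, since otherwise it would give a second occurrence; so `b`
is determined by its position (`val_apply_of_occ_eq_singleton`). Cycling the three entries to
`b, c, a` turns the permutation into a skew sum `σ ⊖ τ` of two 1-2-3-avoiding permutations: `σ`
fills the positions up to `j`, has `b` as its least entry and does not end with it, while `τ` is
arbitrary and nonempty. Conversely every such pair arises once (`card_singleEndingAt`); this adapts
Burstein's proof of Noonan's formula for permutations with one occurrence of 321.

The 1-2-3-avoiding permutations are counted by Catalan numbers (`card_avoiders`): refining the count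
by a threshold `m` above which the entries decrease and removing the first entry gives the recurrence
of Catalan's triangle. Those that end with their least entry are counted by the previous Catalan
number (`card_avoiders_last_eq_zero`). Hence the generating function is
`(C - 1 - x C) (C - 1)`, which equals `x ^ 3 C ^ 5` because `C = 1 + x C ^ 2`. The same relation
makes `x` times it linear in `C`, so its coefficients are combinations of three consecutive Catalan
numbers, from which the closed form follows.
-/

/-! ### Permutations avoiding 1-2-3 -/

/-- `π` has no occurrence of the pattern 1-2-3. -/
def Avoids123 {n : ℕ} (π : Equiv.Perm (Fin n)) : Prop :=
  ∀ i j k, i < j → j < k → π i < π j → ¬ π j < π k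

instance {n : ℕ} : DecidablePred (Avoids123 (n := n)) := fun π => by
  unfold Avoids123; infer_instance

/-- The 1-2-3-avoiding permutations of length `n`. -/
def avoiders (n : ℕ) : Finset (Equiv.Perm (Fin n)) := Finset.univ.filter Avoids123

/-- `π` avoids 1-2-3 and its entries with (zero-based) value at least `m` form a decreasing
sequence. -/
def DecreasingAbove {n : ℕ} (m : ℕ) (π : Equiv.Perm (Fin n)) : Prop :=
  Avoids123 π ∧ ∀ i j, i < j → m ≤ (π i : ℕ) → ¬ π i < π j

instance {n m : ℕ} : DecidablePred (DecreasingAbove (n := n) m) := fun π => by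
  unfold DecreasingAbove; infer_instance

/-- The number of 1-2-3-avoiding permutations of length `n` whose entries with value at least `m`
decrease. -/
def numDecreasingAbove (n m : ℕ) : ℕ :=
  (Finset.univ.filter (DecreasingAbove (n := n) m)).card

/-- The permutation with first entry `v` whose other entries are in the same relative order as
those of `σ`. -/
def consPerm {n : ℕ} (v : Fin (n + 1)) (σ : Equiv.Perm (Fin n)) : Equiv.Perm (Fin (n + 1)) :=
  (finSuccEquiv n).trans (σ.optionCongr.trans (finSuccEquiv' v).symm)

@[simp]
theorem consPerm_zero {n : ℕ} (v : Fin (n + 1)) (σ : Equiv.Perm (Fin n)) :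
    consPerm v σ 0 = v := by
  simp [consPerm]

@[simp]
theorem consPerm_succ {n : ℕ} (v : Fin (n + 1)) (σ : Equiv.Perm (Fin n)) (i : Fin n) :
    consPerm v σ i.succ = v.succAbove (σ i) := by
  simp [consPerm]

theorem consPerm_bijective (n : ℕ) :
    Function.Bijective fun x : Fin (n + 1) × Equiv.Perm (Fin n) => consPerm x.1 x.2 := by
  rw [Fintype.bijective_iff_injective_and_card]
  constructor
  · rintro ⟨v, σ⟩ ⟨w, τ⟩ h
    have hv : v = w := by simpa using Equiv.congr_fun h 0
    subst hv
    have hσ : σ = τ := by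
      ext i
      have := Equiv.congr_fun h i.succ
      simp only [consPerm_succ] at this
      rw [Fin.succAbove_right_injective this]
    rw [hσ]
  · simp [Fintype.card_perm, Nat.factorial_succ]

/-- A property of permutations of length `n + 1` can be counted by first entry. -/
theorem card_filter_perm_succ {n : ℕ} (P : Equiv.Perm (Fin (n + 1)) → Prop) [DecidablePred P] :
    (Finset.univ.filter P).card =
      ∑ v : Fin (n + 1), (Finset.univ.filter fun σ => P (consPerm v σ)).card := by
  simp only [Finset.card_filter]
  rw [← (Equiv.ofBijective _ (consPerm_bijective n)).sum_comp, Fintype.sum_prod_type]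
  rfl

/-- A largest first entry takes part in no ascending pair. -/
theorem decreasingAbove_consPerm_last {n m : ℕ} (σ : Equiv.Perm (Fin n)) :
    DecreasingAbove m (consPerm (Fin.last n) σ) ↔ DecreasingAbove m σ := by
  simp [DecreasingAbove, Avoids123, Fin.forall_fin_succ, Fin.le_last]

/-- A first entry `v` other than the largest is the bottom of an ascending pair; an ascending pair
above it would complete an occurrence of 1-2-3. -/
theorem decreasingAbove_consPerm_castSucc {n m : ℕ} (v : Fin n) (σ : Equiv.Perm (Fin n)) :
    DecreasingAbove m (consPerm v.castSucc σ) ↔ (v : ℕ) < m ∧ DecreasingAbove v σ := by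
  have hlt (i : Fin n) : v.castSucc < v.castSucc.succAbove (σ i) ↔ (v : ℕ) ≤ (σ i : ℕ) := by
    rw [Fin.lt_succAbove_iff_le_castSucc, Fin.castSucc_le_castSucc_iff, Fin.le_def]
  have hval (i : Fin n) : (v.castSucc.succAbove (σ i) : ℕ) =
      if (σ i : ℕ) < v then (σ i : ℕ) else σ i + 1 := by
    simp only [Fin.succAbove, Fin.lt_def, Fin.val_castSucc]
    split_ifs <;> rfl
  simp only [DecreasingAbove, Avoids123, Fin.forall_fin_succ, consPerm_zero, consPerm_succ, hlt,
    Fin.succAbove_lt_succAbove_iff, Fin.succ_lt_succ_iff, Fin.succ_pos, Fin.not_lt_zero,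
    lt_irrefl, Fin.val_castSucc, hval]
  constructor
  · rintro ⟨⟨h1, h2⟩, h3, h4⟩
    have hv : (v : ℕ) < m := by
      by_contra hm
      refine h3.2 (σ.symm v) trivial (by omega) ?_
      simp
    simp at h1 h2
    exact ⟨hv, fun i j k hij hjk a b => (h2 i j k hij hjk a).not_gt b,
      fun i j hij a b => (h1 i j hij a).not_gt b⟩
  · rintro ⟨hv, h1, h2⟩
    simp only [false_imp_iff, implies_true, true_and, forall_const,
      not_false_eq_true, and_true]
    refine ⟨⟨fun i j hij a => h2 i j hij a, h1⟩, fun h => by omega, fun i j hij a => h2 i j hij ?_⟩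
    split_ifs at a <;> omega

theorem numDecreasingAbove_succ {n m : ℕ} :
    numDecreasingAbove (n + 1) m = numDecreasingAbove n m +
      ∑ v ∈ Finset.range (min m n), numDecreasingAbove n v := by
  unfold numDecreasingAbove
  rw [card_filter_perm_succ, Fin.sum_univ_castSucc, add_comm]
  simp only [decreasingAbove_consPerm_last, decreasingAbove_consPerm_castSucc]
  congr 1
  have h (v : Fin n) : (Finset.univ.filter fun σ : Equiv.Perm (Fin n) =>
      (v : ℕ) < m ∧ DecreasingAbove v σ).card =
      if (v : ℕ) < m then (Finset.univ.filter (DecreasingAbove (n := n) v)).card else 0 := by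
    split_ifs with hv <;> simp [hv]
  rw [Finset.sum_congr rfl fun v _ => h v,
    Fin.sum_univ_eq_sum_range (fun v => if v < m then
      (Finset.univ.filter (DecreasingAbove (n := n) v)).card else 0), ← Finset.sum_filter]
  congr 1
  ext v
  simp [and_comm]

theorem numDecreasingAbove_of_le {n m : ℕ} (h : n ≤ m) :
    numDecreasingAbove n m = (avoiders n).card := by
  unfold numDecreasingAbove avoiders
  congr 1
  refine Finset.filter_congr fun π _ => ⟨fun hπ => hπ.1, fun hπ => ⟨hπ, fun i j _ hi => ?_⟩⟩
  have := (π i).isLt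
  omega

theorem numDecreasingAbove_zero_right (n : ℕ) : numDecreasingAbove n 0 = 1 := by
  induction n with
  | zero => decide
  | succ n ih => simp [numDecreasingAbove_succ, ih]

/-- The recurrence of Catalan's triangle. -/
theorem numDecreasingAbove_succ_succ {n m : ℕ} (h : m < n) :
    numDecreasingAbove (n + 1) (m + 1) =
      numDecreasingAbove (n + 1) m + numDecreasingAbove n (m + 1) := by
  rw [numDecreasingAbove_succ, numDecreasingAbove_succ, min_eq_left h, min_eq_left h.le,
    Finset.sum_range_succ]
  ring

theorem numDecreasingAbove_succ_self (n : ℕ) :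
    numDecreasingAbove (n + 1) (n + 1) = numDecreasingAbove (n + 1) n := by
  rw [numDecreasingAbove_succ, numDecreasingAbove_succ, min_eq_right n.le_succ, min_self,
    numDecreasingAbove_of_le n.le_succ, numDecreasingAbove_of_le le_rfl]

/-- The ballot numbers `(n + m + 1).choose (m + 1) - (n + m + 1).choose m`. -/
theorem numDecreasingAbove_add_choose (n m : ℕ) (h : m < n) :
    numDecreasingAbove n (m + 1) + (n + m + 1).choose m = (n + m + 1).choose (m + 1) := by
  induction n generalizing m with
  | zero => omega
  | succ n ihn =>
    induction m with
    | zero =>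
      rcases Nat.eq_zero_or_pos n with rfl | hn
      · decide
      · have := ihn 0 hn
        rw [numDecreasingAbove_succ_succ hn, numDecreasingAbove_zero_right]
        simp at this ⊢
        omega
    | succ m ihm =>
      have h1 := ihm (by omega)
      have e : n + 1 + (m + 1) + 1 = (n + m + 2) + 1 := by ring
      rw [e, Nat.choose_succ_succ' (n + m + 2) m, Nat.choose_succ_succ' (n + m + 2) (m + 1)]
      rw [show n + 1 + m + 1 = n + m + 2 by ring] at h1
      rcases Nat.lt_or_ge (m + 1) n with hmn | hmn
      · have h2 := ihn (m + 1) hmn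
        rw [show n + (m + 1) + 1 = n + m + 2 by ring] at h2
        rw [numDecreasingAbove_succ_succ hmn]
        omega
      · obtain rfl : n = m + 1 := by omega
        rw [numDecreasingAbove_succ_self]
        have h2 : (m + 1 + m + 2).choose (m + 1 + 1) = (m + 1 + m + 2).choose (m + 1) := by
          rw [← Nat.choose_symm_of_eq_add]; ring
        omega

/-- The 1-2-3-avoiding permutations are counted by the Catalan numbers. -/
theorem card_avoiders (n : ℕ) : (avoiders n).card = catalan n := by
  rcases n with _ | n
  · rw [catalan_zero]; decide
  · have h := numDecreasingAbove_add_choose (n + 1) n n.lt_succ_self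
    rw [numDecreasingAbove_of_le le_rfl] at h
    have hc := succ_mul_catalan_eq_centralBinom (n + 1)
    have hr := Nat.choose_succ_right_eq (n + 1 + n + 1) n
    rw [Nat.centralBinom, show 2 * (n + 1) = n + 1 + n + 1 by ring] at hc
    rw [show n + 1 + n + 1 - n = n + 2 by omega, ← h, add_mul] at hr
    rw [← h] at hc
    refine Nat.eq_of_mul_eq_mul_left (show 0 < n + 1 + 1 by omega) ?_
    rw [hc]
    linarith

theorem avoids123_consPerm_last {n : ℕ} (σ : Equiv.Perm (Fin n)) :
    Avoids123 (consPerm (Fin.last n) σ) ↔ Avoids123 σ := by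
  simp [Avoids123, Fin.forall_fin_succ, Fin.le_last]

/-- The pattern 1-2-3 is invariant under reverse-complement. -/
theorem Avoids123.reverseComplement {n : ℕ} {σ : Equiv.Perm (Fin n)} (h : Avoids123 σ) :
    Avoids123 (Fin.revPerm * σ * Fin.revPerm) := by
  intro i j k hij hjk h1 h2
  simp only [Equiv.Perm.mul_apply, Fin.revPerm_apply, Fin.rev_lt_rev] at h1 h2
  exact h _ _ _ (Fin.rev_lt_rev.2 hjk) (Fin.rev_lt_rev.2 hij) h2 h1

/-- The avoiding permutations that end with their least entry: that entry can be deleted. -/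
theorem card_avoiders_last_eq_zero (n : ℕ) :
    ((avoiders (n + 1)).filter fun σ => σ (Fin.last n) = 0).card = catalan n := by
  have hrev : (Fin.revPerm * Fin.revPerm : Equiv.Perm (Fin (n + 1))) = 1 := by
    ext; simp
  rw [← card_avoiders]
  refine (Finset.card_bij (fun σ _ => Fin.revPerm * consPerm (Fin.last n) σ * Fin.revPerm)
    ?_ ?_ ?_).symm
  · intro σ hσ
    simp only [avoiders, Finset.mem_filter, Finset.mem_univ, true_and] at hσ ⊢
    exact ⟨((avoids123_consPerm_last σ).2 hσ).reverseComplement, by simp⟩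
  · intro σ _ τ _ h
    have h' := (consPerm_bijective n).1 (a₁ := (Fin.last n, σ)) (a₂ := (Fin.last n, τ))
      (mul_left_cancel (mul_right_cancel h))
    exact (Prod.ext_iff.1 h').2
  · intro π hπ
    simp only [avoiders, Finset.mem_filter, Finset.mem_univ, true_and] at hπ
    obtain ⟨⟨v, σ⟩, h⟩ := (consPerm_bijective n).2 (Fin.revPerm * π * Fin.revPerm)
    simp only at h
    have hv : v = Fin.last n := by
      have := Equiv.congr_fun h 0
      simpa [hπ.2] using this
    subst hv
    refine ⟨σ, ?_, ?_⟩
    · simp only [avoiders, Finset.mem_filter, Finset.mem_univ, true_and]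
      rw [← avoids123_consPerm_last, h]
      exact hπ.1.reverseComplement
    · rw [h, mul_assoc, mul_assoc, mul_assoc, hrev, mul_one, ← mul_assoc, hrev, one_mul]

/-- The avoiding permutations that do not end with their least entry. -/
theorem card_avoiders_last_ne_zero (n : ℕ) :
    ((avoiders (n + 1)).filter fun σ => σ (Fin.last n) ≠ 0).card + catalan n =
      catalan (n + 1) := by
  rw [← card_avoiders_last_eq_zero, ← card_avoiders (n + 1), add_comm]
  exact Finset.card_filter_add_card_filter_not _

/-! ### Skew sums -/

/-- The skew sum `σ ⊖ τ`: the entries of `σ`, raised by `q`, followed by the entries of `τ`. -/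
def skewSum {p q : ℕ} (σ : Equiv.Perm (Fin p)) (τ : Equiv.Perm (Fin q)) :
    Equiv.Perm (Fin (p + q)) :=
  finSumFinEquiv.symm.trans ((Equiv.Perm.sumCongr σ τ).trans
    ((finSumFinEquiv.trans finAddFlip).trans (finCongr (Nat.add_comm q p))))

theorem val_skewSum_castAdd {p q : ℕ} (σ : Equiv.Perm (Fin p)) (τ : Equiv.Perm (Fin q))
    (i : Fin p) : (skewSum σ τ (Fin.castAdd q i) : ℕ) = q + σ i := by
  simp [skewSum, Nat.add_comm]

theorem val_skewSum_natAdd {p q : ℕ} (σ : Equiv.Perm (Fin p)) (τ : Equiv.Perm (Fin q))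
    (i : Fin q) : (skewSum σ τ (Fin.natAdd p i) : ℕ) = τ i := by
  simp [skewSum]

theorem lt_iff_le_skewSum {p q : ℕ} (σ : Equiv.Perm (Fin p)) (τ : Equiv.Perm (Fin q))
    (x : Fin (p + q)) : (x : ℕ) < p ↔ q ≤ (skewSum σ τ x : ℕ) := by
  induction x using Fin.addCases with
  | left i => rw [val_skewSum_castAdd]; simp
  | right i => rw [val_skewSum_natAdd]; have := (τ i).isLt; simp

theorem skewSum_injective {p q : ℕ} {σ σ' : Equiv.Perm (Fin p)} {τ τ' : Equiv.Perm (Fin q)}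
    (h : skewSum σ τ = skewSum σ' τ') : σ = σ' ∧ τ = τ' := by
  constructor
  · ext i
    have := val_skewSum_castAdd σ τ i
    rw [h, val_skewSum_castAdd] at this
    omega
  · ext i
    have := val_skewSum_natAdd σ τ i
    rw [h, val_skewSum_natAdd] at this
    omega

/-- A permutation that maps the first `p` positions to the largest `p` values is a skew sum. -/
theorem exists_eq_skewSum {p q : ℕ} (ρ : Equiv.Perm (Fin (p + q)))
    (h : ∀ x : Fin (p + q), (x : ℕ) < p → q ≤ (ρ x : ℕ)) :
    ∃ σ τ, ρ = skewSum (p := p) (q := q) σ τ := by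
  let e : Fin p ⊕ Fin q ≃ Fin (p + q) :=
    (finSumFinEquiv.trans finAddFlip).trans (finCongr (Nat.add_comm q p))
  let θ : Equiv.Perm (Fin p ⊕ Fin q) := finSumFinEquiv.trans (ρ.trans e.symm)
  have hθ : Set.MapsTo θ (Set.range Sum.inl) (Set.range Sum.inl) := by
    rintro _ ⟨i, rfl⟩
    rcases hx : θ (Sum.inl i) with j | j
    · exact ⟨j, rfl⟩
    · have h1 : ρ (Fin.castAdd q i) = e (Sum.inr j) := by
        rw [← hx]; simp [θ]
      have h2 := h (Fin.castAdd q i) (by simp)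
      rw [h1] at h2
      simp [e] at h2
      have := j.isLt
      omega
  obtain ⟨⟨σ, τ⟩, hστ⟩ := Equiv.Perm.mem_sumCongrHom_range_of_perm_mapsTo_inl hθ
  refine ⟨σ, τ, ?_⟩
  have h3 : Equiv.Perm.sumCongr σ τ = θ := hστ
  ext x
  simp [skewSum, h3, θ, e]

theorem avoids123_skewSum {p q : ℕ} (σ : Equiv.Perm (Fin p)) (τ : Equiv.Perm (Fin q)) :
    Avoids123 (skewSum σ τ) ↔ Avoids123 σ ∧ Avoids123 τ := by
  constructor
  · intro h
    constructor
    · intro i j k hij hjk h1 h2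
      refine h (Fin.castAdd q i) (Fin.castAdd q j) (Fin.castAdd q k) hij hjk ?_ ?_ <;>
        rw [Fin.lt_def, val_skewSum_castAdd, val_skewSum_castAdd] <;> simpa
    · intro i j k hij hjk h1 h2
      refine h (Fin.natAdd p i) (Fin.natAdd p j) (Fin.natAdd p k) (by simpa) (by simpa) ?_ ?_ <;>
        rw [Fin.lt_def, val_skewSum_natAdd, val_skewSum_natAdd] <;> simpa
  · rintro ⟨hσ, hτ⟩ i j k hij hjk h1 h2
    -- the entries of the first block exceed those of the second, so an ascent stays in one block
    have hi := lt_iff_le_skewSum σ τ i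
    have hj := lt_iff_le_skewSum σ τ j
    have hk := lt_iff_le_skewSum σ τ k
    rw [Fin.lt_def] at hij hjk h1 h2
    by_cases hp : (i : ℕ) < p
    · obtain ⟨i, rfl⟩ : ∃ x, i = Fin.castAdd q x := ⟨⟨i, hp⟩, rfl⟩
      obtain ⟨j, rfl⟩ : ∃ x, j = Fin.castAdd q x := ⟨⟨j, by omega⟩, rfl⟩
      obtain ⟨k, rfl⟩ : ∃ x, k = Fin.castAdd q x := ⟨⟨k, by omega⟩, rfl⟩
      rw [val_skewSum_castAdd, val_skewSum_castAdd] at h1 h2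
      exact hσ i j k hij hjk (Fin.lt_def.2 (by omega)) (Fin.lt_def.2 (by omega))
    · obtain ⟨i, rfl⟩ : ∃ x, i = Fin.natAdd p x :=
        ⟨⟨i - p, by omega⟩, Fin.ext (by simp; omega)⟩
      obtain ⟨j, rfl⟩ : ∃ x, j = Fin.natAdd p x :=
        ⟨⟨j - p, by omega⟩, Fin.ext (by simp; omega)⟩
      obtain ⟨k, rfl⟩ : ∃ x, k = Fin.natAdd p x :=
        ⟨⟨k - p, by omega⟩, Fin.ext (by simp; omega)⟩
      rw [val_skewSum_natAdd, val_skewSum_natAdd] at h1 h2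
      simp only [Fin.val_natAdd] at hij hjk
      exact hτ i j k (Fin.lt_def.2 (by omega)) (Fin.lt_def.2 (by omega)) h1 h2

/-! ### Exchanging a single occurrence for none -/

theorem mem_occ_1_2_3 {n : ℕ} {π : Equiv.Perm (Fin n)} {i j k : Fin n} :
    (i, j, k) ∈ occ_1_2_3 π ↔ i < j ∧ j < k ∧ π i < π j ∧ π j < π k := by
  simp [occ_1_2_3]

/-- The cycle `i ↦ k ↦ j ↦ i` (for distinct `i`, `j`, `k`). -/
def threeCycle {n : ℕ} (i j k : Fin n) : Equiv.Perm (Fin n) :=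
  Equiv.swap i j * Equiv.swap i k

/-- If `(i, j, k)`, with `k = j + 1`, is the only occurrence of 1-2-3, then exactly the entries at
the positions below `k` other than `i` and `j`, and the one at `k`, exceed the entry at `j`. This
determines the value at `j`. -/
theorem lt_apply_iff_of_occ_eq_singleton {n : ℕ} {π : Equiv.Perm (Fin n)} {i j k : Fin n}
    (hocc : occ_1_2_3 π = {(i, j, k)}) (hjk : (j : ℕ) + 1 = k) (x : Fin n) :
    π j < π x ↔ x ≤ k ∧ x ≠ i ∧ x ≠ j := by
  have hm : (i, j, k) ∈ occ_1_2_3 π := by simp [hocc]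
  rw [mem_occ_1_2_3] at hm
  obtain ⟨hij, hjk', h1, h2⟩ := hm
  have huniq (a b c : Fin n) (h : a < b ∧ b < c ∧ π a < π b ∧ π b < π c) :
      (a, b, c) = (i, j, k) := by
    rw [← mem_occ_1_2_3, hocc] at h
    simpa using h
  constructor
  · intro hx
    refine ⟨?_, ?_, ?_⟩
    · by_contra hk
      have := huniq i j x ⟨hij, by omega, h1, hx⟩
      simp at this
      omega
    · rintro rfl; exact absurd hx h1.not_gt
    · rintro rfl; exact absurd hx (lt_irrefl _)
  · rintro ⟨hxk, hxi, hxj⟩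
    by_contra hlt
    rcases eq_or_ne x k with rfl | hne
    · exact hlt h2
    have hπ : π x ≠ π j := fun h => hxj (π.injective h)
    have := huniq x j k ⟨by omega, hjk', by omega, h2⟩
    simp at this
    exact hxi this

theorem val_apply_of_occ_eq_singleton {n : ℕ} {π : Equiv.Perm (Fin n)} {i j k : Fin n}
    (hocc : occ_1_2_3 π = {(i, j, k)}) (hjk : (j : ℕ) + 1 = k) :
    (π j : ℕ) + k = n := by
  have hm : (i, j, k) ∈ occ_1_2_3 π := by simp [hocc]
  rw [mem_occ_1_2_3] at hm
  have h1 : (Finset.Ioi (π j)).card = n - 1 - π j := Fin.card_Ioi _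
  have h2 : (Finset.Ioi (π j)) = (((Finset.Iic k).erase i).erase j).map π.toEmbedding := by
    ext y
    obtain ⟨x, rfl⟩ := π.surjective y
    have := lt_apply_iff_of_occ_eq_singleton hocc hjk x
    simp [this]
    tauto
  rw [h2, Finset.card_map, Finset.card_erase_of_mem, Finset.card_erase_of_mem, Fin.card_Iic] at h1
  · have := (π j).isLt
    have := k.isLt
    omega
  · simp; omega
  · simp; omega

/-- The skew decomposable permutation obtained by a 3-cycle of the entries of the single occurrence
avoids 1-2-3. -/
theorem avoids123_of_occ_eq_singleton {n : ℕ} {π ρ : Equiv.Perm (Fin n)} {i j k : Fin n}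
    (hocc : occ_1_2_3 π = {(i, j, k)}) (hjk : (j : ℕ) + 1 = k)
    (hi : ρ i = π j) (hj : ρ j = π k) (hk : ρ k = π i)
    (hρ : ∀ x, x ≠ i → x ≠ j → x ≠ k → ρ x = π x) :
    Avoids123 ρ ∧ ρ i < ρ j ∧ ∀ x, x < k ↔ ρ i ≤ ρ x := by
  have hm : (i, j, k) ∈ occ_1_2_3 π := by simp [hocc]
  rw [mem_occ_1_2_3] at hm
  obtain ⟨hij, hjk', h1, h2⟩ := hm
  have huniq (a b c : Fin n) (h : a < b ∧ b < c ∧ π a < π b ∧ π b < π c) :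
      b = j := by
    rw [← mem_occ_1_2_3, hocc] at h
    simp at h
    exact h.2.1
  have hblock (x : Fin n) : x < k ↔ ρ i ≤ ρ x := by
    have := lt_apply_iff_of_occ_eq_singleton hocc hjk x
    by_cases hxi : x = i
    · subst hxi; simp; omega
    by_cases hxj : x = j
    · subst hxj; rw [hi, hj]; simp [h2.le, hjk']
    by_cases hxk : x = k
    · subst hxk; rw [hi, hk]; simp [h1]
    have hne : π x ≠ π j := fun h => hxj (π.injective h)
    rw [hi, hρ x hxi hxj hxk]
    constructor
    · intro h; exact (this.2 ⟨h.le, hxi, hxj⟩).le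
    · intro h; exact lt_of_le_of_ne (this.1 (lt_of_le_of_ne h hne.symm)).1 hxk
  refine ⟨?_, by rw [hi, hj]; exact h2, hblock⟩
  intro a b c hab hbc hab' hbc'
  have ha := hblock a
  have hb := hblock b
  have hc := hblock c
  have hbi : b ≠ i := by rintro rfl; omega
  have hci : c ≠ i := by rintro rfl; omega
  rcases lt_or_ge a k with hak | hak
  · -- within the first block: raise the least entry, move the last one from `j` to `k`
    have hbk : b < k := by omega
    have hck : c < k := by omega
    have hbj : b ≠ j := by rintro rfl; omega
    have haj : a ≠ j := by rintro rfl; omega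
    have hπa : π a ≤ ρ a := by
      by_cases hai : a = i
      · subst hai; rw [hi]; exact h1.le
      · rw [hρ a hai haj (by omega)]
    have hπb := hρ b hbi hbj (by omega)
    by_cases hcj : c = j
    · subst hcj
      exact hbj (huniq a b k ⟨hab, hbk, by omega, by omega⟩)
    · have hπc := hρ c hci hcj (by omega)
      exact hbj (huniq a b c ⟨hab, hbc, by omega, by omega⟩)
  · -- within the second block: move the first entry from `k` to `i`
    have hπb := hρ b hbi (by omega) (by omega)
    have hπc := hρ c hci (by omega) (by omega)
    by_cases hak' : a = k
    · subst hak'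
      have := huniq i b c ⟨by omega, hbc, by omega, by omega⟩
      omega
    · have hπa := hρ a (by omega) (by omega) hak'
      have := huniq a b c ⟨hab, hbc, by omega, by omega⟩
      omega

/-- The converse of `avoids123_of_occ_eq_singleton`. -/
theorem occ_eq_singleton_of_avoids123 {n : ℕ} {π ρ : Equiv.Perm (Fin n)} {i j k : Fin n}
    (hjk : (j : ℕ) + 1 = k) (hij : i ≠ j)
    (hi : ρ i = π j) (hj : ρ j = π k) (hk : ρ k = π i)
    (hρ : ∀ x, x ≠ i → x ≠ j → x ≠ k → ρ x = π x)
    (havoid : Avoids123 ρ) (hblock : ∀ x, x < k ↔ ρ i ≤ ρ x) :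
    occ_1_2_3 π = {(i, j, k)} := by
  have hik : i < k := (hblock i).2 le_rfl
  have hne : ρ i ≠ ρ j := fun h => hij (ρ.injective h)
  have hbj := hblock j
  have hbk := hblock k
  ext ⟨a, b, c⟩
  rw [mem_occ_1_2_3, Finset.mem_singleton]
  constructor
  · rintro ⟨hab, hbc, hab', hbc'⟩
    have ha := hblock a
    have hb := hblock b
    have hc := hblock c
    have hb' (h : b ≠ i) : ρ b ≠ ρ i := fun h' => h (ρ.injective h')
    rcases lt_trichotomy b j with hbj' | rfl | hbj'
    · have hbi : b ≠ i := by
        rintro rfl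
        have := hρ a (by omega) (by omega) (by omega)
        omega
      have := hb' hbi
      have hπb := hρ b hbi (by omega) (by omega)
      have hci : c ≠ i := by rintro rfl; omega
      have hcj : c ≠ j := by rintro rfl; omega
      have hρa : ρ a < ρ b := by
        by_cases hai : a = i
        · subst hai; omega
        · have := hρ a hai (by omega) (by omega)
          omega
      by_cases hck : c = k
      · subst hck
        exact absurd (by omega) (havoid a b j hab hbj' hρa)
      · have := hρ c hci hcj hck
        exact absurd (by omega) (havoid a b c hab hbc hρa)
    · have hck : c = k := by
        by_contra hck
        have := hρ c (by omega) (by omega) hck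
        omega
      have hai : a = i := by
        by_contra hai
        have := hρ a hai (by omega) (by omega)
        omega
      rw [hai, hck]
    · have hck := hρ c (by omega) (by omega) (by omega)
      have hbk' : b ≠ k := by rintro rfl; omega
      have hπb := hρ b (by omega) (by omega) hbk'
      by_cases hai : a = i
      · subst hai
        exact absurd (by omega) (havoid k b c (by omega) hbc (by omega))
      · have haj : a ≠ j := by rintro rfl; omega
        have hak : a ≠ k := by rintro rfl; omega
        have := hρ a hai haj hak
        exact absurd (by omega) (havoid a b c hab hbc (by omega))
  · rintro h
    simp only [Prod.mk.injEq] at h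
    obtain ⟨rfl, rfl, rfl⟩ := h
    refine ⟨by omega, by omega, by omega, by omega⟩

/-! ### Counting by the position of the occurrence -/

theorem threeCycle_apply_left {n : ℕ} {i j k : Fin n} (hik : i ≠ k) (hjk : j ≠ k) :
    threeCycle i j k i = k := by
  simp [threeCycle, Equiv.swap_apply_of_ne_of_ne hik.symm hjk.symm]

theorem threeCycle_apply_mid {n : ℕ} {i j k : Fin n} (hij : i ≠ j) (hjk : j ≠ k) :
    threeCycle i j k j = i := by
  simp [threeCycle, Equiv.swap_apply_of_ne_of_ne hij.symm hjk]

theorem threeCycle_apply_right {n : ℕ} {i j k : Fin n} : threeCycle i j k k = j := by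
  simp [threeCycle]

theorem threeCycle_apply_of_ne {n : ℕ} {i j k x : Fin n} (hi : x ≠ i) (hj : x ≠ j)
    (hk : x ≠ k) : threeCycle i j k x = x := by
  simp [threeCycle, Equiv.swap_apply_of_ne_of_ne, hi, hj, hk]

/-- The permutations of length `p + q` with a single occurrence of 1-2-3, which ends with two
adjacent positions, the latter of them being position `p`. -/
def singleEndingAt (p q : ℕ) : Finset (Equiv.Perm (Fin (p + q))) :=
  Finset.univ.filter fun π =>
    ∃ i j k, occ_1_2_3 π = {(i, j, k)} ∧ (j : ℕ) + 1 = k ∧ (k : ℕ) = p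

theorem singleEndingAt_zero_left (q : ℕ) : singleEndingAt 0 q = ∅ := by
  ext π
  simp only [singleEndingAt, Finset.mem_filter, Finset.mem_univ, true_and, Finset.notMem_empty,
    iff_false]
  rintro ⟨i, j, k, -, h1, h2⟩
  omega

theorem singleEndingAt_zero_right (p : ℕ) : singleEndingAt p 0 = ∅ := by
  ext π
  simp only [singleEndingAt, Finset.mem_filter, Finset.mem_univ, true_and, Finset.notMem_empty,
    iff_false]
  rintro ⟨i, j, k, -, h1, h2⟩
  omega

/-- The skew sum of `σ` and `τ`, with a 3-cycle applied to the entries at the position of the least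
entry of `σ`, the last position of `σ` and the first position of `τ`, so that the entries there
become the only occurrence of 1-2-3. -/
def cycledSkewSum {p q : ℕ} (σ : Equiv.Perm (Fin (p + 1))) (τ : Equiv.Perm (Fin (q + 1))) :
    Equiv.Perm (Fin (p + 1 + (q + 1))) :=
  skewSum σ τ *
    threeCycle (Fin.castAdd _ (σ.symm 0)) (Fin.castAdd _ (Fin.last p)) (Fin.natAdd _ 0)

theorem occ_cycledSkewSum {p q : ℕ} {σ : Equiv.Perm (Fin (p + 1))}
    {τ : Equiv.Perm (Fin (q + 1))} (hσ : Avoids123 σ) (hτ : Avoids123 τ)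
    (hlast : σ (Fin.last p) ≠ 0) :
    occ_1_2_3 (cycledSkewSum σ τ) =
      {(Fin.castAdd _ (σ.symm 0), Fin.castAdd _ (Fin.last p), Fin.natAdd _ 0)} := by
  have hij' : σ.symm 0 ≠ Fin.last p := fun h => hlast (by rw [← h]; simp)
  have hij : Fin.castAdd (q + 1) (σ.symm 0) ≠ Fin.castAdd (q + 1) (Fin.last p) := by simpa
  have hne (x : Fin (p + 1)) : Fin.castAdd (q + 1) x ≠ Fin.natAdd (p + 1) (0 : Fin (q + 1)) := by
    intro h
    have := congrArg Fin.val h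
    have := x.isLt
    simp at *
    omega
  refine occ_eq_singleton_of_avoids123 (ρ := skewSum σ τ) (by simp) hij ?_ ?_ ?_ ?_
    ((avoids123_skewSum σ τ).2 ⟨hσ, hτ⟩) ?_
  · rw [cycledSkewSum, Equiv.Perm.mul_apply, threeCycle_apply_mid hij (hne _)]
  · rw [cycledSkewSum, Equiv.Perm.mul_apply, threeCycle_apply_right]
  · rw [cycledSkewSum, Equiv.Perm.mul_apply, threeCycle_apply_left (hne _) (hne _)]
  · intro x hi hj hk
    rw [cycledSkewSum, Equiv.Perm.mul_apply, threeCycle_apply_of_ne hi hj hk]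
  · intro x
    rw [Fin.le_def, val_skewSum_castAdd, Fin.lt_def, Equiv.apply_symm_apply]
    simpa using lt_iff_le_skewSum σ τ x

/-- `cycledSkewSum` is a bijection onto the permutations with a single occurrence, ending at
`p + 1`. -/
theorem card_singleEndingAt (p q : ℕ) :
    (singleEndingAt (p + 1) (q + 1)).card =
      ((avoiders (p + 1)).filter fun σ => σ (Fin.last p) ≠ 0).card * catalan (q + 1) := by
  rw [← card_avoiders (q + 1), ← Finset.card_product]
  refine (Finset.card_bij (fun x _ => cycledSkewSum x.1 x.2) ?_ ?_ ?_).symm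
  · rintro ⟨σ, τ⟩ h
    simp only [avoiders, Finset.mem_product, Finset.mem_filter, Finset.mem_univ, true_and] at h
    simp only [singleEndingAt, Finset.mem_filter, Finset.mem_univ, true_and]
    exact ⟨_, _, _, occ_cycledSkewSum h.1.1 h.2 h.1.2, by simp, by simp⟩
  · rintro ⟨σ, τ⟩ h ⟨σ', τ'⟩ h' heq
    simp only [avoiders, Finset.mem_product, Finset.mem_filter, Finset.mem_univ, true_and] at h h'
    simp only at heq
    -- the occurrence recovers the cycle, hence the skew sum
    have hocc := occ_cycledSkewSum h.1.1 h.2 h.1.2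
    rw [heq, occ_cycledSkewSum h'.1.1 h'.2 h'.1.2, Finset.singleton_inj] at hocc
    have hi := congrArg Prod.fst hocc
    simp only at hi
    unfold cycledSkewSum at heq
    rw [hi] at heq
    have := skewSum_injective (mul_right_cancel heq)
    rw [this.1, this.2]
  · intro π hπ
    simp only [singleEndingAt, Finset.mem_filter, Finset.mem_univ, true_and] at hπ
    obtain ⟨i, j, k, hocc, hjk, hk⟩ := hπ
    have hm : (i, j, k) ∈ occ_1_2_3 π := by simp [hocc]
    rw [mem_occ_1_2_3] at hm
    obtain ⟨hij, hjk', -, -⟩ := hm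
    obtain ⟨ρ, hπ⟩ : ∃ ρ, π = ρ * threeCycle i j k := ⟨π * (threeCycle i j k)⁻¹, by simp⟩
    have hval := val_apply_of_occ_eq_singleton hocc hjk
    have hπj : π j = ρ i := by
      rw [hπ, Equiv.Perm.mul_apply, threeCycle_apply_mid hij.ne hjk'.ne]
    obtain ⟨havoid, hlt, hblock⟩ := avoids123_of_occ_eq_singleton (ρ := ρ) hocc hjk hπj.symm
      (by rw [hπ, Equiv.Perm.mul_apply, threeCycle_apply_right])
      (by rw [hπ, Equiv.Perm.mul_apply, threeCycle_apply_left (hij.trans hjk').ne hjk'.ne])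
      (fun x h1 h2 h3 => by rw [hπ, Equiv.Perm.mul_apply, threeCycle_apply_of_ne h1 h2 h3])
    rw [hπj] at hval
    obtain ⟨σ, τ, hστ⟩ := exists_eq_skewSum (p := p + 1) (q := q + 1) ρ (fun x hx => by
      have := (hblock x).1 (by omega)
      omega)
    obtain rfl : k = Fin.natAdd (p + 1) 0 := Fin.ext (by simpa using hk)
    obtain rfl : j = Fin.castAdd (q + 1) (Fin.last p) := Fin.ext (by simp at hjk ⊢; omega)
    obtain ⟨i, rfl⟩ : ∃ x, i = Fin.castAdd (q + 1) x := ⟨⟨i, by omega⟩, rfl⟩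
    have hi : σ i = 0 := by
      rw [hστ, val_skewSum_castAdd, hk] at hval
      exact Fin.ext (show (σ i : ℕ) = 0 by omega)
    rw [hστ, avoids123_skewSum] at havoid
    refine ⟨(σ, τ), ?_, ?_⟩
    · simp only [avoiders, Finset.mem_product, Finset.mem_filter, Finset.mem_univ, true_and]
      refine ⟨⟨havoid.1, fun h => ?_⟩, havoid.2⟩
      rw [hστ, Fin.lt_def, val_skewSum_castAdd, val_skewSum_castAdd, hi, h] at hlt
      exact lt_irrefl _ hlt
    · have hi' : σ.symm 0 = i := by rw [← hi]; simp
      simp only [cycledSkewSum, hi']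
      rw [← hστ, ← hπ]

/-- Every occurrence of 1-23 is one of 1-2-3, so both patterns occur once exactly when the single
occurrence of 1-2-3 ends with adjacent positions. -/
theorem card_occ_eq_one_iff {n : ℕ} (π : Equiv.Perm (Fin n)) :
    ((occ_1_23 π).card = 1 ∧ (occ_1_2_3 π).card = 1) ↔
      ∃ i j k, occ_1_2_3 π = {(i, j, k)} ∧ (j : ℕ) + 1 = k := by
  have hfilter : occ_1_23 π = (occ_1_2_3 π).filter fun t => (t.2.1 : ℕ) + 1 = t.2.2 := by
    ext ⟨i, j, k⟩
    simp only [occ_1_23, occ_1_2_3, Finset.mem_filter, Finset.mem_univ, true_and]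
    constructor
    · rintro ⟨h1, h2, h3, h4⟩
      exact ⟨⟨h1, by omega, h3, h4⟩, h2.symm⟩
    · rintro ⟨⟨h1, -, h3, h4⟩, h2⟩
      exact ⟨h1, h2.symm, h3, h4⟩
  rw [hfilter]
  constructor
  · rintro ⟨h1, h2⟩
    obtain ⟨⟨i, j, k⟩, h⟩ := Finset.card_eq_one.1 h2
    refine ⟨i, j, k, h, ?_⟩
    by_contra hjk
    simp [h, Finset.filter_singleton, hjk] at h1
  · rintro ⟨i, j, k, h, hjk⟩
    simp [h, Finset.filter_singleton, hjk]

theorem numSingle_eq_sum (n : ℕ) :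
    numSingle n = ∑ x ∈ Finset.HasAntidiagonal.antidiagonal n, (singleEndingAt x.1 x.2).card := by
  -- the third position of the occurrence, when there is only one
  let third (π : Equiv.Perm (Fin n)) : ℕ := ∑ t ∈ occ_1_2_3 π, (t.2.2 : ℕ)
  have hthird {π : Equiv.Perm (Fin n)} {i j k : Fin n} (h : occ_1_2_3 π = {(i, j, k)}) :
      third π = k := by simp [third, h]
  unfold numSingle
  rw [Finset.card_eq_sum_card_fiberwise (f := fun π => (third π, n - third π))
    (t := Finset.HasAntidiagonal.antidiagonal n)]
  · refine Finset.sum_congr rfl ?_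
    rintro ⟨p, q⟩ hpq
    rw [Finset.HasAntidiagonal.mem_antidiagonal] at hpq
    simp only at hpq
    subst hpq
    congr 1
    ext π
    simp only [singleEndingAt, Finset.mem_filter, Finset.mem_univ, true_and, card_occ_eq_one_iff,
      Prod.mk.injEq]
    constructor
    · rintro ⟨⟨i, j, k, h, hjk⟩, hp, -⟩
      exact ⟨i, j, k, h, hjk, by rw [← hthird h, hp]⟩
    · rintro ⟨i, j, k, h, hjk, hp⟩
      have := hthird h
      exact ⟨⟨i, j, k, h, hjk⟩, by omega, by omega⟩
  · intro π hπ
    simp only [Finset.coe_filter, Finset.mem_univ, true_and, Set.mem_ofPred_eq,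
      card_occ_eq_one_iff] at hπ
    obtain ⟨i, j, k, h, -⟩ := hπ
    simp only [Finset.mem_coe, Finset.HasAntidiagonal.mem_antidiagonal, hthird h]
    omega

/-! ### The generating function -/

theorem coeff_catalanGF_eq_catalan (n : ℕ) : PowerSeries.coeff n catalanGF = (catalan n : ℚ) := by
  simp [catalanGF]

theorem constantCoeff_catalanGF : PowerSeries.constantCoeff catalanGF = 1 := by
  rw [← PowerSeries.coeff_zero_eq_constantCoeff_apply, coeff_catalanGF_eq_catalan, catalan_zero,
    Nat.cast_one]

theorem catalanGF_sq_mul_X_add_one : catalanGF ^ 2 * PowerSeries.X + 1 = catalanGF := by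
  have h := congrArg (PowerSeries.map (Nat.castRingHom ℚ))
    PowerSeries.catalanSeries_sq_mul_X_add_one
  simpa [catalanGF] using h

theorem coeff_mul_coeff_eq_card_singleEndingAt (p q : ℕ) :
    PowerSeries.coeff p (catalanGF - 1 - PowerSeries.X * catalanGF) *
      PowerSeries.coeff q (catalanGF - 1) = ((singleEndingAt p q).card : ℚ) := by
  rcases p with _ | p
  · simp [singleEndingAt_zero_left, constantCoeff_catalanGF]
  rcases q with _ | q
  · simp [singleEndingAt_zero_right, constantCoeff_catalanGF]
  rw [card_singleEndingAt, Nat.cast_mul]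
  have h : (_ : ℚ) = _ := congrArg Nat.cast (card_avoiders_last_ne_zero p)
  rw [Nat.cast_add] at h
  rw [eq_sub_of_add_eq h]
  simp [coeff_catalanGF_eq_catalan, PowerSeries.coeff_one, PowerSeries.coeff_succ_X_mul]

/-- The first factor counts the avoiding permutations of positive length that do not end with their
least entry, the second all avoiding permutations of positive length. -/
theorem mk_numSingle_eq_mul :
    PowerSeries.mk (fun n => (numSingle n : ℚ)) =
      (catalanGF - 1 - PowerSeries.X * catalanGF) * (catalanGF - 1) := by
  ext n
  rw [PowerSeries.coeff_mk, PowerSeries.coeff_mul, numSingle_eq_sum, Nat.cast_sum]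
  exact Finset.sum_congr rfl fun x _ =>
    (coeff_mul_coeff_eq_card_singleEndingAt x.1 x.2).symm

/-- Multiplication by `X` makes the generating function linear in `catalanGF`. -/
theorem X_mul_mk_numSingle :
    PowerSeries.X * PowerSeries.mk (fun n => (numSingle n : ℚ)) =
      catalanGF - 1 + PowerSeries.X * (2 - 3 * catalanGF + PowerSeries.X * catalanGF) := by
  rw [mk_numSingle_eq_mul]
  linear_combination (1 - PowerSeries.X) * catalanGF_sq_mul_X_add_one

theorem numSingle_eq_catalan (n : ℕ) :
    (numSingle (n + 2) : ℚ) = catalan (n + 3) - 3 * catalan (n + 2) + catalan (n + 1) := by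
  have h := congrArg (PowerSeries.coeff (n + 3)) X_mul_mk_numSingle
  have e : (2 - 3 * catalanGF + PowerSeries.X * catalanGF : PowerSeries ℚ) =
      PowerSeries.C 2 - PowerSeries.C 3 * catalanGF + PowerSeries.X * catalanGF := by
    rw [map_ofNat, map_ofNat]
  rw [e] at h
  simp only [map_add, map_sub, PowerSeries.coeff_succ_X_mul, PowerSeries.coeff_mk,
    PowerSeries.coeff_one, PowerSeries.coeff_C, PowerSeries.coeff_C_mul,
    coeff_catalanGF_eq_catalan] at h
  simp at h
  linarith

/-- The ratio of consecutive Catalan numbers. -/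
theorem catalan_succ_cast (n : ℕ) :
    ((n : ℚ) + 2) * catalan (n + 1) = 2 * (2 * n + 1) * catalan n := by
  have h1 := succ_mul_catalan_eq_centralBinom n
  have h2 := succ_mul_catalan_eq_centralBinom (n + 1)
  have h3 := Nat.succ_mul_centralBinom_succ n
  rw [← h1, ← h2] at h3
  have h4 : ((n : ℚ) + 1) * ((n + 1 + 1) * catalan (n + 1)) =
      2 * (2 * n + 1) * ((n + 1) * catalan n) := by exact_mod_cast h3
  have h0 : (n : ℚ) + 1 ≠ 0 := by positivity
  apply mul_left_cancel₀ h0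
  linear_combination h4

theorem choose_eq_catalan (n : ℕ) :
    ((n : ℚ) + 2) * ((2 * n).choose (n + 2) : ℚ) = n * (n - 1) * catalan n := by
  have h0 : (((n + 1) * catalan n : ℕ) : ℚ) = ((2 * n).choose n : ℚ) := by
    rw [succ_mul_catalan_eq_centralBinom, Nat.centralBinom]
  have h1 := Nat.choose_succ_right_eq (2 * n) n
  have h2 := Nat.choose_succ_right_eq (2 * n) (n + 1)
  rw [show 2 * n - n = n by omega] at h1
  rcases n with _ | n
  · simp
  rw [show 2 * (n + 1) - (n + 1 + 1) = n by omega] at h2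
  have h1' : _ = (_ : ℚ) := congrArg Nat.cast h1
  have h2' : _ = (_ : ℚ) := congrArg Nat.cast h2
  push_cast at h0 h1' h2' ⊢
  have h3 : (n : ℚ) + 1 + 1 ≠ 0 := by positivity
  apply mul_left_cancel₀ h3
  linear_combination ((n : ℚ) + 1 + 1) * h2' + (n : ℚ) * h1' - (n : ℚ) * (n + 1) * h0

theorem theorem8 :
    PowerSeries.mk (fun n => (numSingle n : ℚ)) = PowerSeries.X ^ 3 * catalanGF ^ 5 ∧
    ∀ n : ℕ, 3 ≤ n →
      (numSingle n : ℚ) = 5 / ((n : ℚ) + 2) * ((2 * n - 2).choose (n + 1) : ℚ) := by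
  constructor
  · rw [mk_numSingle_eq_mul]
    have h := catalanGF_sq_mul_X_add_one
    have h1 : catalanGF - 1 = PowerSeries.X * catalanGF ^ 2 := by linear_combination -h
    have h2 : catalanGF - 1 - PowerSeries.X * catalanGF =
        PowerSeries.X ^ 2 * catalanGF ^ 3 := by
      linear_combination h1 + PowerSeries.X * catalanGF * h1
    rw [h2, h1]
    ring
  · intro n hn
    obtain ⟨n, rfl⟩ := Nat.exists_eq_add_of_le' (show 2 ≤ n by omega)
    rw [numSingle_eq_catalan, show 2 * (n + 2) - 2 = 2 * (n + 1) by omega]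
    have h1 := catalan_succ_cast (n + 1)
    have h2 := catalan_succ_cast (n + 2)
    have h3 := choose_eq_catalan (n + 1)
    push_cast at *
    have e1 : (n : ℚ) + 3 ≠ 0 := by positivity
    have e2 : (n : ℚ) + 4 ≠ 0 := by positivity
    have h1' : (catalan (n + 2) : ℚ) = 2 * (2 * n + 3) / (n + 3) * catalan (n + 1) := by
      field_simp
      linear_combination h1
    have h2' : (catalan (n + 3) : ℚ) = 2 * (2 * n + 5) / (n + 4) * catalan (n + 2) := by
      field_simp
      linear_combination h2
    have h3' : ((2 * (n + 1)).choose (n + 2 + 1) : ℚ) =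
        (n + 1) * n / (n + 3) * catalan (n + 1) := by
      field_simp
      linear_combination h3
    rw [h2', h1', h3']
    have e3 : (n : ℚ) + 2 + 2 ≠ 0 := by positivity
    field_simp
    ring
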